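/- Let $0<\alpha<1$, $\tau>0$, $\mathbb K\in\{\mathbb R,\mathbb C\}$, $\lambda,y_0\in\mathbb K$, let $f:(0,\infty)\to\mathbb K$ be any function, and let $\phi(t)=(t/\tau+1)\,y_0$ for $t\in[-\tau,0]$. *Caputo problem.* For a function $y$ that is absolutely continuous on $[0,T]$ for every $T>0$, the Caputo derivative of order $\alpha$ is $${}^{C}\!D^\alpha_0y(t)=\frac1{\Gamma(1-\alpha)}\int_0^t(t-s)^{-\alpha}y'(s)\,ds ,$$ which is said to exist at $t$ if the integral converges absolutely. Let $y:[-\tau,\infty)\to\mathbb K$ be continuous, absolutely continuous on $[0,T]$ for every $T>0$, such that for every $t>0$ the derivative ${}^{C}\!D^\alpha_0y(t)$ exists and $${}^{C}\!D^\alpha_0y(t)=\lambda\,y(t-\tau)+f(t)\quad(t>0),\qquad y(t)=\phi(t)\quad(-\tau<t\le0).$$ *Modified problem.* For $\hat y:[-\tau,\infty)\to\mathbb K$ let $\hat y^{\phi}(t)=\phi(-\tau)$ for $t<-\tau$, $\hat y^{\phi}(t)=\phi(t)$ for $-\tau\le t\le0$ and $\hat y^{\phi}(t)=\hat y(t)$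 for $t>0$, and define the modified operator as the Grünwald–Letnikov derivative of $\hat y^\phi$, $${}^{\phi_\tau}\!D^\alpha_0\hat y(t)=\lim_{h\to0^+}\frac1{h^\alpha}\sum_{j=0}^\infty\omega_j^{(\alpha)}\,\hat y^{\phi}(t-jh),\qquad \omega_j^{(\alpha)}=\frac{(-1)^j\,\Gamma(\alpha+1)}{j!\,\Gamma(\alpha-j+1)} .$$ Let $\hat y:[-\tau,\infty)\to\mathbb K$ be continuous, such that for every $t>0$ this limit exists (with convergent series for all small $h>0$) and $${}^{\phi_\tau}\!D^\alpha_0\hat y(t)=\lambda\,\hat y(t-\tau)+f(t)\quad(t>0),\qquad \hat y(t)=\phi(t)\quad(-\tau<t\le0).$$ Then for every $t>0$ $$\hat y(t)-y(t)=\frac{y_0}{\tau}\sum_{k=0}^{\lfloor t/\tau\rfloor}\lambda^k\left[\frac{(t-k\tau)^{\alpha k+1}}{\Gamma(\alpha k+2)}-\frac{(t+\tau-k\tau)^{\alpha k+1}}{\Gamma(\alpha k+2)}\Bigl(1-I_{\frac{\tau}{t+\tau-k\tau}}\bigl(2-\alpha,(k+1)\alpha\bigr)\Bigr)\right],$$ where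 $I_x(a,b)=\frac1{B(a,b)}\int_0^xr^{a-1}(1-r)^{b-1}\,dr$ is the regularized incomplete Beta function. -/

import Mathlib

open Set Filter Topology MeasureTheory

/-- The Riemann-Liouville integral of order `β` with starting point `t₀`:
`(1 / Γ(β)) ∫_{t₀}^t (t - s)^(β - 1) u(s) ds`. -/
noncomputable def rlIntegral {𝕜 : Type*} [RCLike 𝕜] (β t₀ : ℝ) (u : ℝ → 𝕜) (t : ℝ) : 𝕜 :=
  (1 / Real.Gamma β) • ∫ s in t₀..t, (t - s) ^ (β - 1) • u s

/-- `y` has at `t` the Caputo derivative `L` of order `α ∈ (0,1)` with starting point `0`: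
the integral defining `J_0^(1-α) y'(t)` converges absolutely and has the value `L`. -/
def HasCaputoDerivAt {𝕜 : Type*} [RCLike 𝕜] (α : ℝ) (y : ℝ → 𝕜) (L : 𝕜) (t : ℝ) : Prop :=
  IntervalIntegrable (fun s => (t - s) ^ ((1 - α) - 1) • deriv y s) volume 0 t ∧
    rlIntegral (1 - α) 0 (deriv y) t = L

/-- The Grünwald-Letnikov coefficients `ω_j = (-1)^j Γ(α+1) / (j! Γ(α-j+1))`. -/
noncomputable def glCoeff (α : ℝ) (j : ℕ) : ℝ :=
  (-1) ^ j * Real.Gamma (α + 1) / ((j.factorial : ℝ) * Real.Gamma (α - j + 1))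

/-- `u : ℝ → 𝕜` has at `t` the Grünwald-Letnikov derivative `L` of order `α`: the series
`∑ ω_j u(t - j h)` converges for all small `h > 0`, and its product with `h^(-α)` tends to `L`
as `h` tends to `0` from the right. -/
def HasGLDerivAt {𝕜 : Type*} [RCLike 𝕜] (α : ℝ) (u : ℝ → 𝕜) (L : 𝕜) (t : ℝ) : Prop :=
  (∀ᶠ h : ℝ in 𝓝[>] 0, Summable fun j : ℕ => glCoeff α j • u (t - j * h)) ∧
    Tendsto (fun h : ℝ => (1 / h ^ α) • ∑' j : ℕ, glCoeff α j • u (t - j * h))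
      (𝓝[>] 0) (𝓝 L)

/-- The extension of the history `φ` on `[-τ, 0]` by the constant `φ(-τ)` to the left of `-τ`. -/
noncomputable def historyExt {𝕜 : Type*} (τ : ℝ) (φ : ℝ → 𝕜) (t : ℝ) : 𝕜 :=
  if t < -τ then φ (-τ) else φ t

/-- The function that equals the extended history for `t ≤ 0` and `y` for `t > 0`. -/
noncomputable def withHistory {𝕜 : Type*} (τ : ℝ) (φ y : ℝ → 𝕜) (t : ℝ) : 𝕜 :=
  if t ≤ 0 then historyExt τ φ t else y t

/-- The modified operator, which takes the history `φ` into account, exists at `t` for the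
function `y` and has the value `L`. -/
def HasModifiedDerivAt {𝕜 : Type*} [RCLike 𝕜] (α τ : ℝ) (φ y : ℝ → 𝕜) (L : 𝕜) (t : ℝ) : Prop :=
  HasGLDerivAt α (withHistory τ φ y) L t

/-- `y` solves the linear Caputo delay equation `D y(t) = λ y(t-τ) + f(t)`, `t > 0`, with
history `φ`. Local absolute continuity on `[0, ∞)` is what makes `J_0^(1-α) y'` meaningful. -/
structure IsCaputoSolution {𝕜 : Type*} [RCLike 𝕜] (α τ : ℝ) (lam : 𝕜) (f φ y : ℝ → 𝕜) :
    Prop where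
  continuousOn : ContinuousOn y (Ici (-τ))
  absolutelyContinuous : ∀ T : ℝ, 0 < T → AbsolutelyContinuousOnInterval y 0 T
  equation : ∀ t : ℝ, 0 < t → HasCaputoDerivAt α y (lam * y (t - τ) + f t) t
  history : ∀ t : ℝ, -τ < t → t ≤ 0 → y t = φ t

/-- `y` solves the same delay equation with the Caputo derivative replaced by the modified
operator. -/
structure IsModifiedSolution {𝕜 : Type*} [RCLike 𝕜] (α τ : ℝ) (lam : 𝕜) (f φ y : ℝ → 𝕜) :
    Prop where
  continuousOn : ContinuousOn y (Ici (-τ))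
  equation : ∀ t : ℝ, 0 < t → HasModifiedDerivAt α τ φ y (lam * y (t - τ) + f t) t
  history : ∀ t : ℝ, -τ < t → t ≤ 0 → y t = φ t

/-- The regularized incomplete Beta function
`I_x(a,b) = (1 / B(a,b)) ∫_0^x r^(a-1) (1-r)^(b-1) dr`. -/
noncomputable def regIncompleteBeta (x a b : ℝ) : ℝ :=
  (1 / ProbabilityTheory.beta a b) * ∫ r in (0 : ℝ)..x, r ^ (a - 1) * (1 - r) ^ (b - 1)

/-! Put `c = y₀ / τ` and `r₊ = max r 0`. Since the history vanishes at `-τ`, its extension is the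
single ramp `c (s + τ)₊` for `s ≤ 0`. The Caputo derivative of `y` is the Grünwald-Letnikov
derivative `D` of `y - y(0)` continued by zero to the left of `0` (`hasGLDerivAt_primitive`). Both
equations thus involve the same operator `D`, and subtracting them removes `f`.

It remains to find a continuous `S`, zero for `s ≤ 0`, such that `D[(s + τ)₊ - s₊ + S] = λ S(s - τ)`
for `s > 0`. The two ramps together equal `τ` for `s > 0`, which matches `c τ = y(0)`. Since `D`
lowers the index of a fractional integral by `α`, such an `S` is a sum over `k` of `λ^k` times
delayed fractional integrals: `D` of the term `k = 0` cancels `D` of the ramps, and `D` of the term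
`k + 1` reproduces the term `k` (`hasGLDerivAt_ramps_add_differenceSum`). The incomplete Beta
function arises from fractionally integrating `(v + τ)^(1 - α)` from `0` instead of `-τ`
(`shiftedFamily_add_one`).

The remainder `Z`, equal to `ŷ - y - c S` for `s > 0`, vanishes for `s ≤ 0` and solves `D Z = λ Z(s
- τ)`. On successive intervals of length `τ` the right side is zero, and a maximum principle
(`eq_zero_of_hasGLDerivAt_zero`) gives `Z = 0`. -/

/-! ### Grünwald-Letnikov coefficients and the asymptotics of their partial sums. -/

section Coefficients

variable {α : ℝ}

/-- Keeps the Gamma values in `glCoeff` away from the poles, where `Real.Gamma` takes the default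
value `0`. -/
theorem sub_natCast_ne_neg_natCast (hα0 : 0 < α) (hα1 : α < 1) (j m : ℕ) : α - j ≠ -(m : ℝ) := by
  intro h
  have h1 : (j : ℝ) = α + m := by linarith
  have h2 : (m : ℝ) < j := by linarith
  have h3 : (j : ℝ) < m + 1 := by linarith
  have h4 : m < j := by exact_mod_cast h2
  have h5 : j < m + 1 := by exact_mod_cast h3
  omega

theorem glCoeff_zero (hα0 : 0 < α) : glCoeff α 0 = 1 := by
  have : Real.Gamma (α + 1) ≠ 0 := (Real.Gamma_pos_of_pos (by linarith)).ne'
  simp [glCoeff, this]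

theorem glCoeff_succ (hα0 : 0 < α) (hα1 : α < 1) (j : ℕ) :
    glCoeff α (j + 1) = glCoeff α j * ((j - α) / (j + 1)) := by
  have h0 : Real.Gamma (α - j) ≠ 0 :=
    Real.Gamma_ne_zero fun m => sub_natCast_ne_neg_natCast hα0 hα1 j m
  have h1 : α - j ≠ 0 := by simpa using sub_natCast_ne_neg_natCast hα0 hα1 j 0
  have h2 : (j.factorial : ℝ) ≠ 0 := by positivity
  have h3 : (j : ℝ) + 1 ≠ 0 := by positivity
  have h4 : α - ((j + 1 : ℕ) : ℝ) + 1 = α - j := by push_cast; ring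
  unfold glCoeff
  rw [h4, Real.Gamma_add_one h1, Nat.factorial_succ, pow_succ]
  push_cast
  field_simp
  ring

/-- The partial sums `ω_0 + ⋯ + ω_n` of the Grünwald-Letnikov coefficients. -/
noncomputable def glPartialSum (α : ℝ) (n : ℕ) : ℝ := ∑ j ∈ Finset.range (n + 1), glCoeff α j

theorem glPartialSum_zero (hα0 : 0 < α) : glPartialSum α 0 = 1 := by
  simp [glPartialSum, glCoeff_zero hα0]

theorem glCoeff_succ_eq_partialSum (hα0 : 0 < α) (hα1 : α < 1) (n : ℕ) :
    glCoeff α (n + 1) = -(α / (n + 1)) * glPartialSum α n := by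
  induction n with
  | zero => rw [glCoeff_succ hα0 hα1, glPartialSum_zero hα0, glCoeff_zero hα0]; simp
  | succ n ih =>
    have h : glPartialSum α (n + 1) = glPartialSum α n + glCoeff α (n + 1) :=
      Finset.sum_range_succ _ _
    rw [glCoeff_succ hα0 hα1, h, ih]
    push_cast
    field_simp
    ring

theorem glPartialSum_succ (hα0 : 0 < α) (hα1 : α < 1) (n : ℕ) :
    glPartialSum α (n + 1) = glPartialSum α n * ((n + 1 - α) / (n + 1)) := by
  have h : glPartialSum α (n + 1) = glPartialSum α n + glCoeff α (n + 1) :=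
    Finset.sum_range_succ _ _
  rw [h, glCoeff_succ_eq_partialSum hα0 hα1]
  field_simp
  ring

theorem glPartialSum_pos (hα0 : 0 < α) (hα1 : α < 1) (n : ℕ) : 0 < glPartialSum α n := by
  induction n with
  | zero => rw [glPartialSum_zero hα0]; norm_num
  | succ n ih =>
    rw [glPartialSum_succ hα0 hα1]
    have : (0 : ℝ) ≤ n := n.cast_nonneg
    exact mul_pos ih (div_pos (by linarith) (by linarith))

theorem glCoeff_succ_nonpos (hα0 : 0 < α) (hα1 : α < 1) (n : ℕ) : glCoeff α (n + 1) ≤ 0 := by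
  rw [glCoeff_succ_eq_partialSum hα0 hα1, neg_mul, neg_nonpos]
  exact mul_nonneg (by positivity) (glPartialSum_pos hα0 hα1 n).le

/-- By Bernoulli's inequality, consecutive values have ratio at most `(1 + x)(1 - x) ≤ 1` with `x =
α / (n + 1)`. Supplies the dominating function in `hasGLDerivAt_primitive`. -/
theorem rpow_mul_glPartialSum_le_one (hα0 : 0 < α) (hα1 : α < 1) (n : ℕ) :
    ((n : ℝ) + 1) ^ α * glPartialSum α n ≤ 1 := by
  induction n with
  | zero => simp [glPartialSum_zero hα0]
  | succ n ih =>
    have hn : (0 : ℝ) < (n : ℝ) + 1 := by positivity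
    have hpos := glPartialSum_pos hα0 hα1 n
    have e : ((n + 1 : ℕ) : ℝ) + 1 = (n + 1) * (1 + 1 / (n + 1)) := by
      push_cast; field_simp
    have hb : (1 + 1 / ((n : ℝ) + 1)) ^ α ≤ 1 + α * (1 / (n + 1)) :=
      rpow_one_add_le_one_add_mul_self (by
        have : (0 : ℝ) ≤ 1 / ((n : ℝ) + 1) := by positivity
        linarith) hα0.le hα1.le
    have hq : ((n : ℝ) + 1 - α) / (n + 1) = 1 - α * (1 / (n + 1)) := by field_simp
    have hx : α * (1 / ((n : ℝ) + 1)) ≤ 1 := by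
      rw [mul_one_div, div_le_one hn]; linarith [(n.cast_nonneg : (0 : ℝ) ≤ n)]
    rw [e, Real.mul_rpow hn.le (by positivity), glPartialSum_succ hα0 hα1, hq]
    set x := α * (1 / ((n : ℝ) + 1))
    have h1 : (1 + 1 / ((n : ℝ) + 1)) ^ α * (1 - x) ≤ 1 := by
      calc _ ≤ (1 + x) * (1 - x) := mul_le_mul_of_nonneg_right hb (by linarith)
        _ ≤ 1 := by nlinarith [sq_nonneg x]
    have h0 : 0 ≤ (1 + 1 / ((n : ℝ) + 1)) ^ α * (1 - x) :=
      mul_nonneg (by positivity) (by linarith)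
    calc _ = ((n : ℝ) + 1) ^ α * glPartialSum α n * ((1 + 1 / ((n : ℝ) + 1)) ^ α * (1 - x)) := by
          ring
      _ ≤ 1 := mul_le_one₀ ih h0 h1

theorem glPartialSum_eq_prod (hα0 : 0 < α) (hα1 : α < 1) (n : ℕ) :
    glPartialSum α n = (∏ j ∈ Finset.range n, (1 - α + j)) / n.factorial := by
  induction n with
  | zero => simp [glPartialSum_zero hα0]
  | succ n ih =>
    rw [glPartialSum_succ hα0 hα1, ih, Finset.prod_range_succ, Nat.factorial_succ]
    push_cast
    field_simp
    ring

theorem tendsto_rpow_mul_glPartialSum (hα0 : 0 < α) (hα1 : α < 1) :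
    Tendsto (fun n : ℕ => (n : ℝ) ^ α * glPartialSum α n) atTop (𝓝 (1 / Real.Gamma (1 - α))) := by
  have hΓ : Real.Gamma (1 - α) ≠ 0 := (Real.Gamma_pos_of_pos (by linarith)).ne'
  have h1 : Tendsto (fun n : ℕ => (n : ℝ) / (n + (1 - α))) atTop (𝓝 1) :=
    tendsto_natCast_div_add_atTop (1 - α)
  -- Euler's limit: the sequence is `n / (n + 1 - α)` divided by `Real.GammaSeq (1 - α) n`.
  refine (h1.div (Real.GammaSeq_tendsto_Gamma (1 - α)) hΓ).congr' ?_
  filter_upwards [eventually_gt_atTop 0] with n hn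
  have hn' : (0 : ℝ) < n := by exact_mod_cast hn
  have hP : 0 < ∏ j ∈ Finset.range n, (1 - α + (j : ℝ)) :=
    Finset.prod_pos fun j _ => by have : (0 : ℝ) ≤ j := j.cast_nonneg
                                  linarith
  have hs : (0 : ℝ) < n + (1 - α) := by linarith
  have hpow : (n : ℝ) ^ (1 - α) = n / (n : ℝ) ^ α := by rw [Real.rpow_sub hn', Real.rpow_one]
  have hpp : (0 : ℝ) < (n : ℝ) ^ α := Real.rpow_pos_of_pos hn' _
  have hf : (0 : ℝ) < n.factorial := by positivity
  simp only [Pi.div_apply, Real.GammaSeq]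
  rw [Finset.prod_range_succ, glPartialSum_eq_prod hα0 hα1, hpow, add_comm (1 - α) (n : ℝ)]
  field_simp

theorem tendsto_glPartialSum_floor (hα0 : 0 < α) (hα1 : α < 1) {r : ℝ} (hr : 0 < r) :
    Tendsto (fun h : ℝ => 1 / h ^ α * glPartialSum α ⌊r / h⌋₊) (𝓝[>] 0)
      (𝓝 (1 / Real.Gamma (1 - α) * r ^ (-α))) := by
  have hx : Tendsto (fun h : ℝ => r / h) (𝓝[>] 0) atTop :=
    (tendsto_inv_nhdsGT_zero.const_mul_atTop hr).congr fun h => (div_eq_mul_inv r h).symm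
  have hn : Tendsto (fun h : ℝ => ⌊r / h⌋₊) (𝓝[>] 0) atTop := tendsto_nat_floor_atTop.comp hx
  have hr1 : Tendsto (fun h : ℝ => r * ((⌊r / h⌋₊ : ℝ) / (r / h))) (𝓝[>] 0) (𝓝 (r * 1)) :=
    ((tendsto_nat_floor_div_atTop (R := ℝ)).comp hx).const_mul r
  rw [mul_one] at hr1
  have hp := hr1.rpow_const (p := -α) (Or.inl hr.ne')
  refine (((tendsto_rpow_mul_glPartialSum hα0 hα1).comp hn).mul hp).congr' ?_
  filter_upwards [self_mem_nhdsWithin, hn.eventually (eventually_gt_atTop 0)] with h hh hpos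
  have hh : 0 < h := hh
  have hN : (0 : ℝ) < (⌊r / h⌋₊ : ℝ) := by exact_mod_cast hpos
  have e : r * ((⌊r / h⌋₊ : ℝ) / (r / h)) = ⌊r / h⌋₊ * h := by field_simp
  have hq : (0 : ℝ) < (⌊r / h⌋₊ : ℝ) ^ α := Real.rpow_pos_of_pos hN _
  have hq' : (0 : ℝ) < h ^ α := Real.rpow_pos_of_pos hh _
  simp only [Function.comp_apply]
  rw [e, Real.mul_rpow hN.le hh.le, Real.rpow_neg hN.le, Real.rpow_neg hh.le]
  field_simp

theorem glPartialSum_floor_le (hα0 : 0 < α) (hα1 : α < 1) {r h : ℝ} (hr : 0 < r) (hh : 0 < h) :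
    1 / h ^ α * glPartialSum α ⌊r / h⌋₊ ≤ r ^ (-α) := by
  have h1 := rpow_mul_glPartialSum_le_one hα0 hα1 ⌊r / h⌋₊
  have h2 : (r / h) ^ α ≤ ((⌊r / h⌋₊ : ℝ) + 1) ^ α :=
    Real.rpow_le_rpow (by positivity) (Nat.lt_floor_add_one _).le hα0.le
  have h3 := (mul_le_mul_of_nonneg_right h2 (glPartialSum_pos hα0 hα1 ⌊r / h⌋₊).le).trans h1
  rw [Real.div_rpow hr.le hh.le] at h3
  have hrp : 0 < r ^ α := Real.rpow_pos_of_pos hr _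
  rw [Real.rpow_neg hr.le, ← one_div, le_div_iff₀ hrp]
  calc _ = r ^ α / h ^ α * glPartialSum α ⌊r / h⌋₊ := by ring
    _ ≤ 1 := h3

end Coefficients

/-! ### The Grünwald-Letnikov derivative: linearity, primitives, uniqueness. -/

section Operator

variable {𝕜 : Type*} [RCLike 𝕜] {𝕜' : Type*} [RCLike 𝕜'] {α t : ℝ}

theorem HasGLDerivAt.map {u : ℝ → 𝕜} {L : 𝕜} (h : HasGLDerivAt α u L t) (A : 𝕜 →L[ℝ] 𝕜') :
    HasGLDerivAt α (fun s => A (u s)) (A L) t := by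
  have hs : ∀ᶠ h : ℝ in 𝓝[>] 0, HasSum (fun j : ℕ => glCoeff α j • A (u (t - j * h)))
      (A (∑' j : ℕ, glCoeff α j • u (t - j * h))) := by
    filter_upwards [h.1] with k hk
    simpa using hk.hasSum.mapL A
  refine ⟨hs.mono fun k hk => hk.summable, ?_⟩
  refine ((A.continuous.tendsto L).comp h.2).congr' ?_
  filter_upwards [hs] with k hk
  simp [hk.tsum_eq]

theorem HasGLDerivAt.add {u v : ℝ → 𝕜} {L M : 𝕜} (hu : HasGLDerivAt α u L t)
    (hv : HasGLDerivAt α v M t) : HasGLDerivAt α (fun s => u s + v s) (L + M) t := by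
  refine ⟨?_, (hu.2.add hv.2).congr' ?_⟩
  · filter_upwards [hu.1, hv.1] with h h1 h2
    simpa only [smul_add] using h1.add h2
  · filter_upwards [hu.1, hv.1] with h h1 h2
    simp only [smul_add, h1.tsum_add h2]

theorem HasGLDerivAt.const_mul {u : ℝ → 𝕜} {L : 𝕜} (h : HasGLDerivAt α u L t) (c : 𝕜) :
    HasGLDerivAt α (fun s => c * u s) (c * L) t :=
  h.map (ContinuousLinearMap.mul ℝ 𝕜 c)

theorem HasGLDerivAt.sub {u v : ℝ → 𝕜} {L M : 𝕜} (hu : HasGLDerivAt α u L t)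
    (hv : HasGLDerivAt α v M t) : HasGLDerivAt α (fun s => u s - v s) (L - M) t := by
  simpa [sub_eq_add_neg] using hu.add (hv.const_mul (-1))

theorem hasGLDerivAt_of_eq_zero {u : ℝ → 𝕜} (hu : ∀ s ≤ t, u s = 0) : HasGLDerivAt α u 0 t := by
  have h : ∀ᶠ h : ℝ in 𝓝[>] 0, ∀ j : ℕ, glCoeff α j • u (t - j * h) = 0 := by
    filter_upwards [self_mem_nhdsWithin] with h hh j
    have hh : 0 < h := hh
    rw [hu _ (by have : 0 ≤ (j : ℝ) * h := by positivity
                 linarith), smul_zero]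
  refine ⟨h.mono fun k hk => by simp only [hk]; exact summable_zero, ?_⟩
  refine tendsto_const_nhds.congr' ?_
  filter_upwards [h] with k hk
  simp [hk]

theorem HasGLDerivAt.sum {ι : Type*} (s : Finset ι) {u : ι → ℝ → 𝕜} {L : ι → 𝕜}
    (h : ∀ i ∈ s, HasGLDerivAt α (u i) (L i) t) :
    HasGLDerivAt α (fun x => ∑ i ∈ s, u i x) (∑ i ∈ s, L i) t := by
  classical
  induction s using Finset.induction_on with
  | empty => simpa using hasGLDerivAt_of_eq_zero (fun _ _ => rfl)
  | insert a s ha ih =>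
    simp only [Finset.sum_insert ha]
    exact (h a (by simp)).add (ih fun i hi => h i (by simp [hi]))

theorem HasGLDerivAt.comp_sub_const {u : ℝ → 𝕜} {L : 𝕜} {a : ℝ}
    (h : HasGLDerivAt α u L (t - a)) : HasGLDerivAt α (fun s => u (s - a)) L t := by
  have e : ∀ (j : ℕ) (h : ℝ), t - j * h - a = t - a - j * h := fun j h => by ring
  simpa only [HasGLDerivAt, e] using h

theorem sum_range_glCoeff_ite {α h r : ℝ} (hh : 0 < h) (hr : 0 ≤ r) {N : ℕ} (hN : r / h < N) :
    ∑ j ∈ Finset.range N, (if (j : ℝ) * h ≤ r then glCoeff α j else 0) =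
      glPartialSum α ⌊r / h⌋₊ := by
  rw [← Finset.sum_filter, glPartialSum]
  congr 1
  ext j
  have hr' : 0 ≤ r / h := by positivity
  simp only [Finset.mem_filter, Finset.mem_range, Nat.lt_succ_iff, Nat.le_floor_iff hr',
    le_div_iff₀ hh]
  refine ⟨fun h => h.2, fun hj => ⟨?_, hj⟩⟩
  have : (j : ℝ) < N := ((le_div_iff₀ hh).2 hj).trans_lt hN
  exact_mod_cast this

/-- Summation by parts: `u s` is counted by exactly those `j` with `j h ≤ t - s`, so its weight is a
partial sum of the coefficients. -/
theorem hasSum_glCoeff_primitive {u : ℝ → 𝕜} (ht : 0 < t) (hu : IntervalIntegrable u volume 0 t)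
    {h : ℝ} (hh : 0 < h) :
    HasSum (fun j : ℕ => glCoeff α j • ∫ x in 0..max (t - j * h) 0, u x)
      (∫ s in 0..t, glPartialSum α ⌊(t - s) / h⌋₊ • u s) := by
  set N := ⌊t / h⌋₊ + 1 with hN
  have hNt : t / h < N := by simpa [hN] using Nat.lt_floor_add_one (t / h)
  have hu' : IntegrableOn u (Ioc 0 t) := (intervalIntegrable_iff_integrableOn_Ioc_of_le ht.le).1 hu
  have hI : ∀ j : ℕ, ∫ x in 0..max (t - j * h) 0, u x =
      ∫ s in Ioc 0 t, (Iic (t - j * h)).indicator u s := by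
    intro j
    rw [intervalIntegral.integral_of_le (le_max_right _ _),
      setIntegral_indicator measurableSet_Iic]
    congr 2
    ext s
    simp only [mem_Ioc, mem_inter_iff, mem_Iic, le_max_iff]
    have : 0 ≤ (j : ℝ) * h := by positivity
    constructor
    · rintro ⟨h1, h2 | h2⟩
      · exact ⟨⟨h1, by linarith⟩, h2⟩
      · linarith
    · rintro ⟨⟨h1, h2⟩, h3⟩
      exact ⟨h1, Or.inl h3⟩
  have hval : ∑ j ∈ Finset.range N, glCoeff α j • ∫ x in 0..max (t - j * h) 0, u x =
      ∫ s in 0..t, glPartialSum α ⌊(t - s) / h⌋₊ • u s := by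
    rw [intervalIntegral.integral_of_le ht.le]
    simp only [hI, ← integral_smul]
    rw [← integral_finsetSum]
    · refine setIntegral_congr_fun measurableSet_Ioc fun s hs => ?_
      have hs' : (t - s) / h < N :=
        (div_le_div_of_nonneg_right (by linarith [hs.1]) hh.le).trans_lt hNt
      rw [← sum_range_glCoeff_ite hh (by linarith [hs.2]) hs', Finset.sum_smul]
      refine Finset.sum_congr rfl fun j _ => ?_
      by_cases hj : (j : ℝ) * h ≤ t - s
      · rw [if_pos hj, indicator_of_mem (by simp only [mem_Iic]; linarith)]
      · rw [if_neg hj, indicator_of_notMem (by simp only [mem_Iic]; linarith), smul_zero, zero_smul]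
    · intro j _
      exact (Integrable.indicator hu' measurableSet_Iic).smul _
  rw [← hval]
  refine hasSum_sum_of_ne_finset_zero fun j hj => ?_
  have hj : (N : ℝ) ≤ j := by simpa using hj
  have : t ≤ j * h := ((div_lt_iff₀ hh).1 (hNt.trans_le hj)).le
  rw [max_eq_right (by linarith), intervalIntegral.integral_same, smul_zero]

/-- The weights `h^(-α) glPartialSum α ⌊(t - s) / h⌋₊` tend to the Caputo kernel and are dominated
by `(t - s)^(-α)`, so dominated convergence applies. -/
theorem hasGLDerivAt_primitive (hα0 : 0 < α) (hα1 : α < 1) {u : ℝ → 𝕜} (ht : 0 < t)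
    (hu : IntervalIntegrable u volume 0 t)
    (hker : IntervalIntegrable (fun s => (t - s) ^ ((1 - α) - 1) • u s) volume 0 t) :
    HasGLDerivAt α (fun s => ∫ x in 0..max s 0, u x) (rlIntegral (1 - α) 0 u t) t := by
  have e : (1 - α) - 1 = -α := by ring
  rw [e] at hker
  refine ⟨?_, ?_⟩
  · filter_upwards [self_mem_nhdsWithin] with h hh
    exact (hasSum_glCoeff_primitive ht hu hh).summable
  have hlim : Tendsto (fun h : ℝ => ∫ s in 0..t,
      (1 / h ^ α * glPartialSum α ⌊(t - s) / h⌋₊) • u s) (𝓝[>] 0)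
      (𝓝 (∫ s in 0..t, (1 / Real.Gamma (1 - α) * (t - s) ^ (-α)) • u s)) := by
    -- At `s = t` the bound can fail, because `0 ^ (-α)` is `0` in Lean.
    have hne : ∀ᵐ s : ℝ, s ≠ t := by simp [ae_iff]
    refine intervalIntegral.tendsto_integral_filter_of_dominated_convergence
      (fun s => ‖(t - s) ^ (-α) • u s‖) ?_ ?_ hker.norm ?_
    · refine Eventually.of_forall fun h => ?_
      have hW : Measurable fun s : ℝ => 1 / h ^ α * glPartialSum α ⌊(t - s) / h⌋₊ :=
        ((measurable_from_nat (f := glPartialSum α)).comp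
          (Nat.measurable_floor.comp ((measurable_const.sub measurable_id).div_const h))).const_mul _
      exact hW.aestronglyMeasurable.smul hu.def'.aestronglyMeasurable
    · filter_upwards [self_mem_nhdsWithin] with h hh
      filter_upwards [hne] with s hst hs
      rw [uIoc_of_le ht.le] at hs
      have hr : 0 < t - s := by
        rcases lt_or_eq_of_le hs.2 with h | h
        · linarith
        · exact absurd h hst
      have hh : 0 < h := hh
      rw [norm_smul, norm_smul]
      refine mul_le_mul_of_nonneg_right ?_ (norm_nonneg _)
      rw [Real.norm_of_nonneg (mul_nonneg (by positivity) (glPartialSum_pos hα0 hα1 _).le),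
        Real.norm_of_nonneg (by positivity)]
      exact glPartialSum_floor_le hα0 hα1 hr hh
    · filter_upwards [hne] with s hst hs
      rw [uIoc_of_le ht.le] at hs
      have hr : 0 < t - s := by
        rcases lt_or_eq_of_le hs.2 with h | h
        · linarith
        · exact absurd h hst
      exact (tendsto_glPartialSum_floor hα0 hα1 hr).smul_const _
  have hv : rlIntegral (1 - α) 0 u t =
      ∫ s in 0..t, (1 / Real.Gamma (1 - α) * (t - s) ^ (-α)) • u s := by
    simp only [rlIntegral, e, mul_smul, intervalIntegral.integral_smul]
  rw [hv]
  refine hlim.congr' ?_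
  filter_upwards [self_mem_nhdsWithin] with h hh
  rw [(hasSum_glCoeff_primitive ht hu hh).tsum_eq]
  simp only [mul_smul, intervalIntegral.integral_smul]

/-- Maximum principle for the Grünwald-Letnikov derivative. -/
theorem nonpos_of_hasGLDerivAt_zero (hα0 : 0 < α) (hα1 : α < 1) {U : ℝ → ℝ} {T : ℝ}
    (hU : ContinuousOn U (Icc 0 T)) (hneg : ∀ s ≤ 0, U s = 0)
    (hD : ∀ s, 0 < s → s ≤ T → HasGLDerivAt α U 0 s) : ∀ s ≤ T, U s ≤ 0 := by
  intro s hs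
  by_contra! hpos
  have hs0 : 0 < s := by
    by_contra! h
    exact hpos.ne' (hneg s h)
  obtain ⟨m, hm, hmax⟩ := isCompact_Icc.exists_isMaxOn ⟨s, hs0.le, hs⟩ hU
  have hM : 0 < U m := hpos.trans_le (hmax ⟨hs0.le, hs⟩)
  have hm0 : 0 < m := by
    by_contra! h
    exact hM.ne' (hneg m h)
  obtain ⟨-, h2⟩ := hD m hm0 hm.2
  -- At a positive maximum `m`, the coefficients with `j ≥ 1` are nonpositive, so replacing `U (m -
  -- j h)` by `U m` for all `j ≤ m / h` only decreases the sum. In the limit, a positive number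
  -- would be at most `0`.
  have hle := le_of_tendsto_of_tendsto
    ((tendsto_glPartialSum_floor hα0 hα1 hm0).mul_const (U m)) h2 (by
      filter_upwards [self_mem_nhdsWithin] with h hh
      have hh : 0 < h := hh
      set N := ⌊m / h⌋₊ + 1 with hN
      have hNt : m / h < N := by simpa [hN] using Nat.lt_floor_add_one (m / h)
      rw [tsum_eq_sum (s := Finset.range N), mul_assoc, smul_eq_mul]
      · refine mul_le_mul_of_nonneg_left ?_ (by positivity)
        rw [glPartialSum, Finset.sum_mul]
        refine Finset.sum_le_sum fun j hj => ?_
        rw [smul_eq_mul]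
        cases j with
        | zero => simp
        | succ j =>
          refine mul_le_mul_of_nonpos_left ?_ (glCoeff_succ_nonpos hα0 hα1 j)
          have h0 : 0 ≤ ((j + 1 : ℕ) : ℝ) * h := by positivity
          rcases le_or_gt (m - ((j + 1 : ℕ) : ℝ) * h) 0 with h1 | h1
          · rw [hneg _ h1]; exact hM.le
          · exact hmax ⟨h1.le, by linarith [hm.2]⟩
      · intro j hj
        have hj : (N : ℝ) ≤ j := by simpa using hj
        have : m ≤ j * h := ((div_lt_iff₀ hh).1 (hNt.trans_le hj)).le
        rw [hneg _ (by linarith), smul_zero])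
  have : 0 < 1 / Real.Gamma (1 - α) * m ^ (-α) * U m := by
    have := Real.Gamma_pos_of_pos (show 0 < 1 - α by linarith)
    positivity
  linarith

theorem eq_zero_of_hasGLDerivAt_zero (hα0 : 0 < α) (hα1 : α < 1) {U : ℝ → 𝕜} {T : ℝ}
    (hU : ContinuousOn U (Icc 0 T)) (hneg : ∀ s ≤ 0, U s = 0)
    (hD : ∀ s, 0 < s → s ≤ T → HasGLDerivAt α U 0 s) : ∀ s ≤ T, U s = 0 := by
  intro s hs
  -- The real functional `v ↦ Re (conj (U s) v)` reduces the claim to the real case and detects `U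
  -- s` through its norm.
  set A : 𝕜 →L[ℝ] ℝ :=
    RCLike.reCLM ∘L ContinuousLinearMap.mul ℝ 𝕜 ((starRingEnd 𝕜) (U s))
  have hA : A (U s) = ‖U s‖ ^ 2 := by
    change RCLike.re ((starRingEnd 𝕜) (U s) * U s) = _
    rw [RCLike.conj_mul]
    norm_cast
  have := nonpos_of_hasGLDerivAt_zero hα0 hα1 (U := fun s => A (U s))
    (A.continuous.comp_continuousOn hU) (fun r hr => by simp [hneg r hr])
    (fun r h0 h1 => by simpa using (hD r h0 h1).map A) s hs
  rw [hA] at this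
  have h0 : ‖U s‖ ^ 2 = 0 := le_antisymm this (by positivity)
  simpa using h0

end Operator

/-! ### Semigroup law of fractional integration. -/

section FractionalKernels

/-- The kernel `x ^ (a - 1) / Γ(a)`, `x > 0`, of the Riemann-Liouville integral of order `a`. -/
noncomputable def fracKernel (a x : ℝ) : ℝ := if 0 < x then x ^ (a - 1) / Real.Gamma a else 0

theorem fracKernel_nonneg {a : ℝ} (ha : 0 < a) (x : ℝ) : 0 ≤ fracKernel a x := by
  have := Real.Gamma_pos_of_pos ha
  unfold fracKernel
  split_ifs with h
  · positivity
  · exact le_rfl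

theorem fracKernel_of_nonpos (a : ℝ) {x : ℝ} (hx : x ≤ 0) : fracKernel a x = 0 :=
  if_neg hx.not_gt

@[fun_prop]
theorem measurable_fracKernel (a : ℝ) : Measurable (fracKernel a) :=
  Measurable.ite measurableSet_Ioi (by fun_prop) measurable_const

/-- The fractional kernel with values in `[0, ∞]`. -/
noncomputable def eFracKernel (a x : ℝ) : ENNReal := ENNReal.ofReal (fracKernel a x)

@[fun_prop]
theorem measurable_eFracKernel (a : ℝ) : Measurable (eFracKernel a) :=
  (measurable_fracKernel a).ennreal_ofReal

theorem lintegral_eq_mul_lintegral_comp_mul_left {x : ℝ} (hx : 0 < x) {F : ℝ → ENNReal}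
    (hF : Measurable F) : ∫⁻ y, F y = ENNReal.ofReal x * ∫⁻ r, F (x * r) := by
  conv_lhs => rw [← Real.smul_map_volume_mul_left hx.ne']
  rw [lintegral_smul_measure, lintegral_map hF (by fun_prop), abs_of_pos hx, smul_eq_mul]

/-- After the substitution `y = x r` the integrand is a multiple of the Beta density, whose mass is
`1`. Working in `[0, ∞]` postpones all integrability questions. -/
theorem lconvolution_eFracKernel {a b : ℝ} (ha : 0 < a) (hb : 0 < b) :
    lconvolution (eFracKernel a) (eFracKernel b) volume = eFracKernel (a + b) := by
  ext x
  rw [lconvolution_def]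
  rcases le_or_gt x 0 with hx | hx
  · have h0 : ∀ y, eFracKernel a y * eFracKernel b (-y + x) = 0 := by
      intro y
      rcases le_or_gt y 0 with hy | hy
      · simp [eFracKernel, fracKernel_of_nonpos a hy]
      · simp [eFracKernel, fracKernel_of_nonpos b (show -y + x ≤ 0 by linarith)]
    rw [lintegral_congr h0, lintegral_zero, eFracKernel, fracKernel_of_nonpos _ hx,
      ENNReal.ofReal_zero]
  have hab : 0 < a + b := by linarith
  have hΓa := Real.Gamma_pos_of_pos ha
  have hΓb := Real.Gamma_pos_of_pos hb
  have hΓab := Real.Gamma_pos_of_pos hab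
  rw [lintegral_eq_mul_lintegral_comp_mul_left hx (by fun_prop)]
  have key : ∀ r, eFracKernel a (x * r) * eFracKernel b (-(x * r) + x) =
      ENNReal.ofReal (fracKernel (a + b) x / x) * ProbabilityTheory.betaPDF a b r := by
    intro r
    have e : -(x * r) + x = x * (1 - r) := by ring
    rw [ProbabilityTheory.betaPDF_eq, eFracKernel, eFracKernel,
      ← ENNReal.ofReal_mul (fracKernel_nonneg ha _),
      ← ENNReal.ofReal_mul (div_nonneg (fracKernel_nonneg hab _) hx.le), e]
    congr 1
    by_cases h : 0 < r ∧ r < 1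
    · have h1 : 0 < 1 - r := by linarith [h.2]
      rw [if_pos h, fracKernel, fracKernel, fracKernel, if_pos (mul_pos hx h.1),
        if_pos (mul_pos hx h1), if_pos hx, Real.mul_rpow hx.le h.1.le, Real.mul_rpow hx.le h1.le,
        ProbabilityTheory.beta, show a + b - 1 = (a - 1) + (b - 1) + 1 by ring,
        Real.rpow_add hx, Real.rpow_add hx, Real.rpow_one]
      field_simp
    · rw [if_neg h, mul_zero, mul_eq_zero]
      rcases le_or_gt r 0 with h0 | h0
      · exact Or.inl (fracKernel_of_nonpos a (mul_nonpos_of_nonneg_of_nonpos hx.le h0))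
      · refine Or.inr (fracKernel_of_nonpos b (mul_nonpos_of_nonneg_of_nonpos hx.le ?_))
        have : ¬ r < 1 := fun h1 => h ⟨h0, h1⟩
        linarith
  have hm : Measurable (ProbabilityTheory.betaPDF a b) :=
    (ProbabilityTheory.measurable_betaPDFReal a b).ennreal_ofReal
  simp only [key]
  rw [lintegral_const_mul _ hm, ProbabilityTheory.lintegral_betaPDF_eq_one ha hb, mul_one,
    ← ENNReal.ofReal_mul hx.le, mul_div_cancel₀ _ hx.ne', eFracKernel]

/-- Families of nonnegative functions on `(0, ∞)`, extended by zero, on which fractional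
integration of order `a` acts by adding `a` to the index. -/
structure IsFracFamily (Φ : ℝ → ℝ → ℝ) : Prop where
  measurable : ∀ b, Measurable (Φ b)
  nonneg : ∀ b, 0 < b → ∀ s, 0 ≤ Φ b s
  eq_zero : ∀ b, 0 < b → ∀ s ≤ 0, Φ b s = 0
  conv : ∀ a b, 0 < a → 0 < b → ∀ x,
    lconvolution (eFracKernel a) (fun s => ENNReal.ofReal (Φ b s)) volume x =
      ENNReal.ofReal (Φ (a + b) x)

theorem isFracFamily_fracKernel : IsFracFamily fracKernel where
  measurable := measurable_fracKernel
  nonneg _ hb := fracKernel_nonneg hb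
  eq_zero b _ _ hs := fracKernel_of_nonpos b hs
  conv _ _ ha hb x := congrFun (lconvolution_eFracKernel ha hb) x

theorem lconvolution_eFracKernel_eq_setLIntegral {a t : ℝ} {F : ℝ → ENNReal}
    (hF : ∀ s ≤ 0, F s = 0) :
    lconvolution (eFracKernel a) F volume t =
      ∫⁻ s in Ioo 0 t, F s * ENNReal.ofReal ((t - s) ^ (a - 1) / Real.Gamma a) := by
  rw [lconvolution_comm, lconvolution_def, ← lintegral_indicator measurableSet_Ioo]
  congr 1
  ext s
  by_cases h : s ∈ Ioo 0 t
  · rw [indicator_of_mem h, eFracKernel, fracKernel, if_pos (by linarith [h.2]),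
      show -s + t = t - s by ring]
  · rw [indicator_of_notMem h]
    rcases le_or_gt s 0 with h0 | h0
    · rw [hF s h0, zero_mul]
    · have : t ≤ s := by
        by_contra! h1
        exact h ⟨h0, h1⟩
      rw [eFracKernel, fracKernel_of_nonpos a (by linarith), ENNReal.ofReal_zero, mul_zero]

/-- Finiteness of the convolution gives absolute convergence, and its value gives the integral. -/
theorem IsFracFamily.integral {Φ : ℝ → ℝ → ℝ} (hΦ : IsFracFamily Φ) {a b t : ℝ} (ha : 0 < a)
    (hb : 0 < b) (ht : 0 < t) :
    IntervalIntegrable (fun s => (t - s) ^ (a - 1) • Φ b s) volume 0 t ∧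
      rlIntegral a 0 (Φ b) t = Φ (a + b) t := by
  have hΓ := Real.Gamma_pos_of_pos ha
  have hmeas : Measurable fun s => (t - s) ^ (a - 1) * Φ b s :=
    Measurable.mul (by fun_prop) (hΦ.measurable b)
  have hnn : ∀ s ∈ Ioo 0 t, 0 ≤ (t - s) ^ (a - 1) * Φ b s := fun s hs =>
    mul_nonneg (Real.rpow_nonneg (by linarith [hs.2]) _) (hΦ.nonneg b hb s)
  have hnn' : 0 ≤ᵐ[volume.restrict (Ioo 0 t)] fun s => (t - s) ^ (a - 1) * Φ b s :=
    (ae_restrict_iff' measurableSet_Ioo).2 (Eventually.of_forall hnn)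
  have hL : ∫⁻ s in Ioo 0 t, ENNReal.ofReal ((t - s) ^ (a - 1) * Φ b s) =
      ENNReal.ofReal (Real.Gamma a * Φ (a + b) t) := by
    rw [ENNReal.ofReal_mul hΓ.le, ← hΦ.conv a b ha hb t,
      lconvolution_eFracKernel_eq_setLIntegral
        (fun s hs => by rw [hΦ.eq_zero b hb s hs, ENNReal.ofReal_zero]),
      ← lintegral_const_mul' _ _ ENNReal.ofReal_ne_top]
    refine setLIntegral_congr_fun measurableSet_Ioo fun s hs => ?_
    have : 0 ≤ (t - s) ^ (a - 1) := Real.rpow_nonneg (by linarith [hs.2]) _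
    rw [← ENNReal.ofReal_mul (hΦ.nonneg b hb s), ← ENNReal.ofReal_mul hΓ.le]
    congr 1
    field_simp
  have hint : IntegrableOn (fun s => (t - s) ^ (a - 1) * Φ b s) (Ioo 0 t) := by
    refine ⟨hmeas.aestronglyMeasurable, ?_⟩
    rw [hasFiniteIntegral_iff_ofReal hnn', hL]
    exact ENNReal.ofReal_lt_top
  simp only [smul_eq_mul, rlIntegral]
  refine ⟨(intervalIntegrable_iff_integrableOn_Ioo_of_le ht.le).2 hint, ?_⟩
  rw [intervalIntegral.integral_of_le ht.le, integral_Ioc_eq_integral_Ioo,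
    integral_eq_lintegral_of_nonneg_ae hnn' hmeas.aestronglyMeasurable, hL,
    ENNReal.toReal_ofReal (mul_nonneg hΓ.le (hΦ.nonneg _ (by linarith) t))]
  field_simp

theorem IsFracFamily.intervalIntegrable {Φ : ℝ → ℝ → ℝ} (hΦ : IsFracFamily Φ) {b : ℝ}
    (hb : 0 < b) (x y : ℝ) : IntervalIntegrable (Φ b) volume x y := by
  have h : ∀ t, IntervalIntegrable (Φ b) volume 0 t := by
    intro t
    rcases le_or_gt t 0 with ht | ht
    · refine (intervalIntegrable_const (c := (0 : ℝ))).congr fun s hs => ?_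
      rw [uIoc_of_ge ht] at hs
      exact (hΦ.eq_zero b hb s hs.2).symm
    · simpa using (hΦ.integral one_pos hb ht).1
  exact (h x).symm.trans (h y)

theorem IsFracFamily.eq_primitive {Φ : ℝ → ℝ → ℝ} (hΦ : IsFracFamily Φ) {b : ℝ} (hb : 0 < b)
    (s : ℝ) : Φ (1 + b) s = ∫ x in 0..max s 0, Φ b x := by
  rcases le_or_gt s 0 with hs | hs
  · rw [max_eq_right hs, intervalIntegral.integral_same, hΦ.eq_zero _ (by linarith) s hs]
  · rw [max_eq_left hs.le, ← (hΦ.integral one_pos hb hs).2]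
    simp [rlIntegral]

theorem IsFracFamily.continuous {Φ : ℝ → ℝ → ℝ} (hΦ : IsFracFamily Φ) {b : ℝ} (hb : 0 < b) :
    Continuous (Φ (1 + b)) := by
  rw [funext (hΦ.eq_primitive hb)]
  exact (intervalIntegral.continuous_primitive (hΦ.intervalIntegrable hb) 0).comp
    (continuous_id.max continuous_const)

/-- `Φ (1 + b)` is the primitive of `Φ b`, and fractional integration of order `1 - α` then raises
`b` to `1 - α + b`: in total the index drops by `α`. -/
theorem IsFracFamily.hasGLDerivAt {Φ : ℝ → ℝ → ℝ} (hΦ : IsFracFamily Φ) {α b : ℝ} (hα0 : 0 < α)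
    (hα1 : α < 1) (hb : 0 < b) (t : ℝ) :
    HasGLDerivAt α (Φ (1 + b)) (Φ (1 - α + b) t) t := by
  rcases le_or_gt t 0 with ht | ht
  · rw [hΦ.eq_zero _ (by linarith) t ht]
    exact hasGLDerivAt_of_eq_zero fun s hs => hΦ.eq_zero _ (by linarith) s (hs.trans ht)
  · have h := hΦ.integral (a := 1 - α) (by linarith) hb ht
    rw [funext (hΦ.eq_primitive hb), ← h.2]
    exact hasGLDerivAt_primitive hα0 hα1 ht (hΦ.intervalIntegrable hb 0 t) h.1

end FractionalKernels

/-! ### Fractional integrals of a shifted power and the incomplete Beta function. -/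

section ShiftedPower

/-- The density of the derivative of `(v + τ) ^ (1 - α) / Γ(2 - α)`, `v > 0`. -/
noncomputable def shiftedDensity (α τ v : ℝ) : ENNReal :=
  ENNReal.ofReal (if 0 < v then (v + τ) ^ (-α) / Real.Gamma (1 - α) else 0)

/-- The fractional integrals of order `b - 1` of `(v + τ) ^ (1 - α) / Γ(2 - α)`, `v > 0`. -/
noncomputable def shiftedFamily (α τ b s : ℝ) : ℝ :=
  τ ^ (1 - α) / Real.Gamma (2 - α) * fracKernel b s +
    (lconvolution (eFracKernel b) (shiftedDensity α τ) volume s).toReal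

variable {α τ : ℝ}

@[fun_prop]
theorem measurable_shiftedDensity : Measurable (shiftedDensity α τ) :=
  (Measurable.ite measurableSet_Ioi (by fun_prop) measurable_const).ennreal_ofReal

theorem shiftedDensity_of_nonpos {v : ℝ} (hv : v ≤ 0) : shiftedDensity α τ v = 0 := by
  simp [shiftedDensity, hv.not_gt]

theorem shiftedDensity_le (hα0 : 0 < α) (hα1 : α < 1) (hτ : 0 < τ) (v : ℝ) :
    shiftedDensity α τ v ≤
      ENNReal.ofReal (τ ^ (-α) / Real.Gamma (1 - α)) * eFracKernel 1 v := by
  have hΓ := Real.Gamma_pos_of_pos (show 0 < 1 - α by linarith)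
  rcases le_or_gt v 0 with hv | hv
  · rw [shiftedDensity_of_nonpos hv]
    exact zero_le
  · rw [eFracKernel, ← ENNReal.ofReal_mul (by positivity), shiftedDensity, if_pos hv, fracKernel,
      if_pos hv]
    refine ENNReal.ofReal_le_ofReal ?_
    simp only [sub_self, Real.rpow_zero, Real.Gamma_one, div_one, mul_one]
    exact div_le_div_of_nonneg_right
      (Real.rpow_le_rpow_of_nonpos hτ (by linarith) (by linarith)) hΓ.le

/-- Makes the convolution finite, so that `toReal` in `shiftedFamily` loses nothing; it also yields
vanishing for `s ≤ 0`. -/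
theorem lconvolution_shiftedDensity_le (hα0 : 0 < α) (hα1 : α < 1) (hτ : 0 < τ) {b : ℝ}
    (hb : 0 < b) (s : ℝ) :
    lconvolution (eFracKernel b) (shiftedDensity α τ) volume s ≤
      ENNReal.ofReal (τ ^ (-α) / Real.Gamma (1 - α)) * eFracKernel (b + 1) s := by
  rw [← lconvolution_eFracKernel hb one_pos, lconvolution_def, lconvolution_def,
    ← lintegral_const_mul' _ _ ENNReal.ofReal_ne_top]
  refine lintegral_mono fun y => ?_
  rw [mul_left_comm]
  exact mul_le_mul_right (shiftedDensity_le hα0 hα1 hτ _) _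

theorem ofReal_shiftedFamily (hα0 : 0 < α) (hα1 : α < 1) (hτ : 0 < τ) {b : ℝ} (hb : 0 < b)
    (s : ℝ) :
    ENNReal.ofReal (shiftedFamily α τ b s) =
      ENNReal.ofReal (τ ^ (1 - α) / Real.Gamma (2 - α)) * eFracKernel b s +
        lconvolution (eFracKernel b) (shiftedDensity α τ) volume s := by
  have hΓ := Real.Gamma_pos_of_pos (show 0 < 2 - α by linarith)
  rw [shiftedFamily, ENNReal.ofReal_add (mul_nonneg (by positivity) (fracKernel_nonneg hb s))
    ENNReal.toReal_nonneg, ENNReal.ofReal_mul (by positivity), ENNReal.ofReal_toReal, eFracKernel]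
  exact ((lconvolution_shiftedDensity_le hα0 hα1 hτ hb s).trans_lt
    (ENNReal.mul_lt_top ENNReal.ofReal_lt_top ENNReal.ofReal_lt_top)).ne

theorem isFracFamily_shiftedFamily (hα0 : 0 < α) (hα1 : α < 1) (hτ : 0 < τ) :
    IsFracFamily (shiftedFamily α τ) where
  measurable b := ((measurable_fracKernel b).const_mul _).add
    (measurable_lconvolution volume (measurable_eFracKernel b)
      measurable_shiftedDensity).ennreal_toReal
  nonneg b hb s := by
    have hΓ := Real.Gamma_pos_of_pos (show 0 < 2 - α by linarith)
    exact add_nonneg (mul_nonneg (by positivity) (fracKernel_nonneg hb s)) ENNReal.toReal_nonneg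
  eq_zero b hb s hs := by
    have h := lconvolution_shiftedDensity_le hα0 hα1 hτ hb s
    rw [eFracKernel, fracKernel_of_nonpos _ hs, ENNReal.ofReal_zero, mul_zero] at h
    rw [shiftedFamily, fracKernel_of_nonpos _ hs, le_antisymm h zero_le]
    simp
  conv a b ha hb x := by
    have hm : Measurable (lconvolution (eFracKernel b) (shiftedDensity α τ) volume) :=
      measurable_lconvolution volume (measurable_eFracKernel b) measurable_shiftedDensity
    rw [ofReal_shiftedFamily hα0 hα1 hτ (by linarith), ← lconvolution_eFracKernel ha hb,
      ← lconvolution_assoc (measurable_eFracKernel a) (measurable_eFracKernel b)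
        measurable_shiftedDensity]
    simp only [ofReal_shiftedFamily hα0 hα1 hτ hb]
    rw [lconvolution_def, lconvolution_def, lconvolution_def (f := eFracKernel a),
      ← lintegral_const_mul' _ _ ENNReal.ofReal_ne_top, ← lintegral_add_left (by fun_prop)]
    refine lintegral_congr fun y => ?_
    ring

theorem shiftedFamily_one (hα1 : α < 1) (hτ : 0 < τ) {t : ℝ} (ht : 0 < t) :
    shiftedFamily α τ 1 t = (t + τ) ^ (1 - α) / Real.Gamma (2 - α) := by
  have hΓ := Real.Gamma_pos_of_pos (show 0 < 1 - α by linarith)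
  have hΓ2 : Real.Gamma (2 - α) = (1 - α) * Real.Gamma (1 - α) := by
    rw [← Real.Gamma_add_one (by linarith)]; congr 1; ring
  have h1 : 1 - α ≠ 0 := by linarith
  have hcont : ContinuousOn (fun s : ℝ => (s + τ) ^ (-α) / Real.Gamma (1 - α)) (Icc 0 t) := by
    refine ContinuousOn.div_const (ContinuousOn.rpow_const (by fun_prop) fun s hs => Or.inl ?_) _
    linarith [hs.1]
  have hint : IntegrableOn (fun s : ℝ => (s + τ) ^ (-α) / Real.Gamma (1 - α)) (Ioo 0 t) :=
    hcont.integrableOn_Icc.mono_set Ioo_subset_Icc_self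
  have hnn : 0 ≤ᵐ[volume.restrict (Ioo 0 t)]
      fun s : ℝ => (s + τ) ^ (-α) / Real.Gamma (1 - α) :=
    (ae_restrict_iff' measurableSet_Ioo).2 (Eventually.of_forall fun s hs =>
      div_nonneg (Real.rpow_nonneg (by linarith [hs.1]) _) hΓ.le)
  have hval : lconvolution (eFracKernel 1) (shiftedDensity α τ) volume t =
      ENNReal.ofReal (∫ s in Ioo 0 t, (s + τ) ^ (-α) / Real.Gamma (1 - α)) := by
    rw [lconvolution_eFracKernel_eq_setLIntegral fun s hs => shiftedDensity_of_nonpos hs,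
      ofReal_integral_eq_lintegral_ofReal hint hnn]
    refine setLIntegral_congr_fun measurableSet_Ioo fun s hs => ?_
    simp [shiftedDensity, hs.1]
  have hI : ∫ s in Ioo 0 t, (s + τ) ^ (-α) / Real.Gamma (1 - α) =
      ((t + τ) ^ (1 - α) - τ ^ (1 - α)) / Real.Gamma (2 - α) := by
    rw [← integral_Ioc_eq_integral_Ioo, ← intervalIntegral.integral_of_le ht.le,
      intervalIntegral.integral_div, intervalIntegral.integral_comp_add_right
        (fun x : ℝ => x ^ (-α)), integral_rpow (Or.inl (by linarith)), hΓ2, zero_add,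
      show -α + 1 = 1 - α by ring]
    field_simp
  rw [shiftedFamily, hval, ENNReal.toReal_ofReal (integral_nonneg_of_ae hnn), hI, fracKernel,
    if_pos ht]
  simp only [sub_self, Real.rpow_zero, Real.Gamma_one, div_one, mul_one]
  ring

theorem intervalIntegrable_betaIntegrand {a b : ℝ} (ha : 0 < a) (hb : 0 < b) :
    IntervalIntegrable (fun r : ℝ => r ^ (a - 1) * (1 - r) ^ (b - 1)) volume 0 1 := by
  have hΓ := Real.Gamma_pos_of_pos ha
  refine ((isFracFamily_fracKernel.integral hb ha one_pos).1.const_mul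
    (Real.Gamma a)).congr fun r hr => ?_
  rw [uIoc_of_le zero_le_one] at hr
  simp only [smul_eq_mul, fracKernel, if_pos hr.1]
  field_simp

theorem integral_betaIntegrand {a b : ℝ} (ha : 0 < a) (hb : 0 < b) :
    ∫ r in (0 : ℝ)..1, r ^ (a - 1) * (1 - r) ^ (b - 1) = ProbabilityTheory.beta a b := by
  have hΓ := Real.Gamma_pos_of_pos ha
  have hΓb := Real.Gamma_pos_of_pos hb
  have h := (isFracFamily_fracKernel.integral hb ha one_pos).2
  rw [rlIntegral, fracKernel, if_pos one_pos, Real.one_rpow] at h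
  have e : ∫ r in (0 : ℝ)..1, (1 - r) ^ (b - 1) • fracKernel a r =
      ∫ r in (0 : ℝ)..1, (1 / Real.Gamma a) * (r ^ (a - 1) * (1 - r) ^ (b - 1)) := by
    rw [intervalIntegral.integral_of_le zero_le_one, intervalIntegral.integral_of_le zero_le_one]
    refine setIntegral_congr_fun measurableSet_Ioc fun r hr => ?_
    simp only [smul_eq_mul, fracKernel, if_pos hr.1]
    ring
  rw [e, intervalIntegral.integral_const_mul, smul_eq_mul] at h
  rw [ProbabilityTheory.beta, add_comm a b]
  field_simp at h ⊢
  linarith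

theorem integral_betaIntegrand_right {a b x : ℝ} (ha : 0 < a) (hb : 0 < b) (hx0 : 0 ≤ x)
    (hx1 : x ≤ 1) :
    ∫ r in x..1, r ^ (a - 1) * (1 - r) ^ (b - 1) =
      ProbabilityTheory.beta a b * (1 - regIncompleteBeta x a b) := by
  have hB := ProbabilityTheory.beta_pos ha hb
  have hI := intervalIntegrable_betaIntegrand ha hb
  have h0 : IntervalIntegrable (fun r : ℝ => r ^ (a - 1) * (1 - r) ^ (b - 1)) volume 0 x :=
    hI.mono_set (uIcc_subset_uIcc left_mem_uIcc (by rw [uIcc_of_le zero_le_one]; exact ⟨hx0, hx1⟩))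
  have h1 : IntervalIntegrable (fun r : ℝ => r ^ (a - 1) * (1 - r) ^ (b - 1)) volume x 1 :=
    h0.symm.trans hI
  have hadd := intervalIntegral.integral_add_adjacent_intervals h0 h1
  rw [integral_betaIntegrand ha hb] at hadd
  rw [regIncompleteBeta, mul_sub, mul_one, ← mul_assoc, mul_one_div_cancel hB.ne', one_mul]
  linarith

/-- The substitution `r = (v + τ) / (s + τ)` turns the fractional integral over `[0, s]` into the
Beta integral over `[τ / (s + τ), 1]`. -/
theorem shiftedFamily_add_one (hα0 : 0 < α) (hα1 : α < 1) (hτ : 0 < τ) {β s : ℝ} (hβ : 0 < β)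
    (hs : 0 ≤ s) :
    shiftedFamily α τ (β + 1) s = (s + τ) ^ (β + 1 - α) / Real.Gamma (β + 2 - α) *
      (1 - regIncompleteBeta (τ / (s + τ)) (2 - α) β) := by
  have h2 : 0 < 2 - α := by linarith
  have hc : 0 < s + τ := by linarith
  have hΓβ := Real.Gamma_pos_of_pos hβ
  have hΓ2 := Real.Gamma_pos_of_pos h2
  have hΓ := Real.Gamma_pos_of_pos (show 0 < β + 2 - α by linarith)
  have hI := integral_betaIntegrand_right h2 hβ (x := τ / (s + τ)) (by positivity)
    ((div_le_one hc).2 (by linarith))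
  have hsub : ∫ v in 0..s, ((v + τ) / (s + τ)) ^ (2 - α - 1) *
      (1 - (v + τ) / (s + τ)) ^ (β - 1) =
      (s + τ) * (ProbabilityTheory.beta (2 - α) β *
        (1 - regIncompleteBeta (τ / (s + τ)) (2 - α) β)) := by
    rw [intervalIntegral.integral_comp_add_right (fun w : ℝ => (w / (s + τ)) ^ (2 - α - 1) *
        (1 - w / (s + τ)) ^ (β - 1)), intervalIntegral.integral_comp_div (fun r : ℝ =>
        r ^ (2 - α - 1) * (1 - r) ^ (β - 1)) hc.ne', zero_add, div_self hc.ne', hI, smul_eq_mul]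
  rcases hs.eq_or_lt with rfl | hs
  · rw [(isFracFamily_shiftedFamily hα0 hα1 hτ).eq_zero _ (by linarith) 0 le_rfl]
    rw [intervalIntegral.integral_same, eq_comm] at hsub
    have hB := ProbabilityTheory.beta_pos h2 hβ
    have : 1 - regIncompleteBeta (τ / (0 + τ)) (2 - α) β = 0 := by
      rcases mul_eq_zero.1 hsub with h | h
      · exact absurd h hc.ne'
      · exact (mul_eq_zero.1 h).resolve_left hB.ne'
    rw [this, mul_zero]
  rw [← ((isFracFamily_shiftedFamily hα0 hα1 hτ).integral hβ one_pos hs).2, rlIntegral]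
  have e : ∫ v in 0..s, (s - v) ^ (β - 1) • shiftedFamily α τ 1 v =
      ∫ v in 0..s, ((s + τ) ^ (β - 1) * (s + τ) ^ (1 - α) / Real.Gamma (2 - α)) *
        (((v + τ) / (s + τ)) ^ (2 - α - 1) * (1 - (v + τ) / (s + τ)) ^ (β - 1)) := by
    rw [intervalIntegral.integral_of_le hs.le, intervalIntegral.integral_of_le hs.le]
    refine setIntegral_congr_fun measurableSet_Ioc fun v hv => ?_
    have e1 : 1 - (v + τ) / (s + τ) = (s - v) / (s + τ) := by field_simp; ring
    simp only [smul_eq_mul]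
    rw [shiftedFamily_one hα1 hτ hv.1, e1, show 2 - α - 1 = 1 - α by ring,
      Real.div_rpow (by linarith [hv.1]) hc.le, Real.div_rpow (by linarith [hv.2]) hc.le]
    have p1 : 0 < (s + τ) ^ (β - 1) := Real.rpow_pos_of_pos hc _
    have p2 : 0 < (s + τ) ^ (1 - α) := Real.rpow_pos_of_pos hc _
    field_simp
  rw [e, intervalIntegral.integral_const_mul, hsub, smul_eq_mul, ProbabilityTheory.beta,
    show β + 1 - α = (β - 1) + (1 - α) + 1 by ring, Real.rpow_add hc, Real.rpow_add hc,
    Real.rpow_one, show 2 - α + β = β + 2 - α by ring]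
  field_simp

end ShiftedPower

/-! ### Fundamental theorem of calculus for absolutely continuous `𝕜`-valued functions, through real
and imaginary parts. -/

section AbsoluteContinuity

variable {𝕜 : Type*} [RCLike 𝕜]

theorem AbsolutelyContinuousOnInterval.clm_comp {E F : Type*} [NormedAddCommGroup E]
    [NormedSpace ℝ E] [NormedAddCommGroup F] [NormedSpace ℝ F] {y : ℝ → E} {a b : ℝ}
    (hy : AbsolutelyContinuousOnInterval y a b) (A : E →L[ℝ] F) :
    AbsolutelyContinuousOnInterval (fun s => A (y s)) a b := by
  rw [absolutelyContinuousOnInterval_iff] at hy ⊢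
  intro ε hε
  have hA : 0 < ‖A‖ + 1 := by positivity
  obtain ⟨δ, hδ, h⟩ := hy (ε / (‖A‖ + 1)) (by positivity)
  refine ⟨δ, hδ, fun I hI hlt => ?_⟩
  calc _ ≤ ∑ i ∈ Finset.range I.1, (‖A‖ + 1) * dist (y (I.2 i).1) (y (I.2 i).2) := by
        refine Finset.sum_le_sum fun i _ => ?_
        rw [dist_eq_norm, dist_eq_norm, ← map_sub]
        exact (A.le_opNorm _).trans (mul_le_mul_of_nonneg_right (by linarith) (norm_nonneg _))
    _ = (‖A‖ + 1) * ∑ i ∈ Finset.range I.1, dist (y (I.2 i).1) (y (I.2 i).2) := by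
        rw [Finset.mul_sum]
    _ < ε := by
        rw [mul_comm, ← lt_div_iff₀ hA]
        exact h I hI hlt

theorem AbsolutelyContinuousOnInterval.ae_hasDerivAt_rclike {y : ℝ → 𝕜} {a b : ℝ}
    (hy : AbsolutelyContinuousOnInterval y a b) :
    ∀ᵐ x, x ∈ uIcc a b → HasDerivAt y (deriv y x) x := by
  filter_upwards [hy.boundedVariationOn.ae_differentiableAt_of_mem_uIcc] with x hx hm
  exact (hx hm).hasDerivAt

theorem AbsolutelyContinuousOnInterval.intervalIntegrable_deriv_rclike {y : ℝ → 𝕜} {a b : ℝ}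
    (hy : AbsolutelyContinuousOnInterval y a b) : IntervalIntegrable (deriv y) volume a b := by
  have hre := (hy.clm_comp RCLike.reCLM).intervalIntegrable_deriv
  have him := (hy.clm_comp RCLike.imCLM).intervalIntegrable_deriv
  have hsum : IntervalIntegrable (fun x => ((deriv (fun s => RCLike.reCLM (y s)) x : ℝ) : 𝕜) +
      ((deriv (fun s => RCLike.imCLM (y s)) x : ℝ) : 𝕜) * RCLike.I) volume a b := by
    refine IntervalIntegrable.add ?_ (IntervalIntegrable.mul_const ?_ _)
    · exact ⟨hre.1.ofReal, hre.2.ofReal⟩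
    · exact ⟨him.1.ofReal, him.2.ofReal⟩
  refine hsum.congr_ae ((ae_restrict_iff' measurableSet_uIoc).2 ?_)
  filter_upwards [hy.ae_hasDerivAt_rclike] with x hx hm
  have h := hx (uIoc_subset_uIcc hm)
  have hA : ∀ A : 𝕜 →L[ℝ] ℝ, deriv (fun s => A (y s)) x = A (deriv y x) := fun A =>
    (A.hasFDerivAt.comp_hasDerivAt x h).deriv
  rw [hA, hA]
  exact RCLike.re_add_im _

theorem AbsolutelyContinuousOnInterval.integral_deriv_eq_sub_rclike {y : ℝ → 𝕜} {a b : ℝ}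
    (hy : AbsolutelyContinuousOnInterval y a b) : ∫ x in a..b, deriv y x = y b - y a := by
  have key : ∀ A : 𝕜 →L[ℝ] ℝ, A (∫ x in a..b, deriv y x) = A (y b - y a) := by
    intro A
    rw [← A.intervalIntegral_comp_comm hy.intervalIntegrable_deriv_rclike, map_sub,
      ← (hy.clm_comp A).integral_deriv_eq_sub]
    refine intervalIntegral.integral_congr_ae ?_
    filter_upwards [hy.ae_hasDerivAt_rclike] with x hx hm
    exact (A.hasFDerivAt.comp_hasDerivAt x (hx (uIoc_subset_uIcc hm))).deriv.symm
  exact RCLike.ext (key RCLike.reCLM) (key RCLike.imCLM)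

end AbsoluteContinuity

/-! ### The explicit difference and its delay equation. -/

section DelayEquation

variable {𝕜 : Type*} [RCLike 𝕜] {α τ : ℝ}

/-- The function multiplying `λ ^ k` in the difference of the two solutions, as a function of
`t - k τ`. -/
noncomputable def differenceTerm (α τ : ℝ) (k : ℕ) (s : ℝ) : ℝ :=
  fracKernel (α * k + 2) s - shiftedFamily α τ ((k + 1) * α + 1) s

theorem differenceTerm_of_nonpos (hα0 : 0 < α) (hα1 : α < 1) (hτ : 0 < τ) (k : ℕ) {s : ℝ}
    (hs : s ≤ 0) : differenceTerm α τ k s = 0 := by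
  rw [differenceTerm, fracKernel_of_nonpos _ hs,
    (isFracFamily_shiftedFamily hα0 hα1 hτ).eq_zero _ (by positivity) s hs, sub_zero]

theorem differenceTerm_of_nonneg (hα0 : 0 < α) (hα1 : α < 1) (hτ : 0 < τ) (k : ℕ) {s : ℝ}
    (hs : 0 ≤ s) : differenceTerm α τ k s =
      s ^ (α * k + 1) / Real.Gamma (α * k + 2) - (s + τ) ^ (α * k + 1) / Real.Gamma (α * k + 2) *
        (1 - regIncompleteBeta (τ / (s + τ)) (2 - α) ((k + 1) * α)) := by
  have hk : 0 < α * k + 1 := by positivity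
  rw [differenceTerm, shiftedFamily_add_one hα0 hα1 hτ (by positivity) hs,
    show ((k : ℝ) + 1) * α + 1 - α = α * k + 1 by ring,
    show ((k : ℝ) + 1) * α + 2 - α = α * k + 2 by ring]
  congr 1
  rcases hs.eq_or_lt with rfl | hs
  · rw [fracKernel_of_nonpos _ le_rfl, Real.zero_rpow hk.ne', zero_div]
  · rw [fracKernel, if_pos hs, show α * k + 2 - 1 = α * k + 1 by ring]

theorem continuous_differenceTerm (hα0 : 0 < α) (hα1 : α < 1) (hτ : 0 < τ) (k : ℕ) :
    Continuous (differenceTerm α τ k) := by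
  have h1 := isFracFamily_fracKernel.continuous (b := α * k + 1) (by positivity)
  have h2 := (isFracFamily_shiftedFamily hα0 hα1 hτ).continuous (b := (k + 1) * α) (by positivity)
  rw [show 1 + (α * k + 1) = α * k + 2 by ring] at h1
  rw [add_comm] at h2
  exact h1.sub h2

theorem hasGLDerivAt_differenceTerm (hα0 : 0 < α) (hα1 : α < 1) (hτ : 0 < τ) (k : ℕ) (s : ℝ) :
    HasGLDerivAt α (differenceTerm α τ k)
      (fracKernel (α * k + 2 - α) s - shiftedFamily α τ (α * k + 1) s) s := by
  have h1 := isFracFamily_fracKernel.hasGLDerivAt hα0 hα1 (b := α * k + 1) (by positivity) s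
  have h2 := (isFracFamily_shiftedFamily hα0 hα1 hτ).hasGLDerivAt hα0 hα1 (b := (k + 1) * α)
    (by positivity) s
  rw [show 1 + (α * k + 1) = α * k + 2 by ring,
    show 1 - α + (α * k + 1) = α * k + 2 - α by ring] at h1
  rw [add_comm, show 1 - α + ((k : ℝ) + 1) * α = α * k + 1 by ring] at h2
  exact h1.sub h2

theorem fracKernel_two (s : ℝ) : fracKernel 2 s = max s 0 := by
  have h2 : Real.Gamma 2 = 1 := by
    rw [show (2 : ℝ) = 1 + 1 by norm_num, Real.Gamma_add_one one_ne_zero, Real.Gamma_one, one_mul]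
  rcases le_or_gt s 0 with hs | hs
  · rw [fracKernel_of_nonpos _ hs, max_eq_right hs]
  · rw [fracKernel, if_pos hs, max_eq_left hs.le, h2, div_one, show (2 : ℝ) - 1 = 1 by norm_num,
      Real.rpow_one]

/-- The sum over `k < N` in the difference of the two solutions. -/
noncomputable def differenceSum (α τ : ℝ) (lam : 𝕜) (N : ℕ) (s : ℝ) : 𝕜 :=
  ∑ k ∈ Finset.range N, lam ^ k * ((differenceTerm α τ k (s - k * τ) : ℝ) : 𝕜)

theorem differenceSum_of_nonpos (hα0 : 0 < α) (hα1 : α < 1) (hτ : 0 < τ) (lam : 𝕜) (N : ℕ) {s : ℝ}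
    (hs : s ≤ 0) : differenceSum α τ lam N s = 0 := by
  refine Finset.sum_eq_zero fun k _ => ?_
  have : 0 ≤ (k : ℝ) * τ := by positivity
  rw [differenceTerm_of_nonpos hα0 hα1 hτ k (by linarith), RCLike.ofReal_zero, mul_zero]

theorem continuous_differenceSum (hα0 : 0 < α) (hα1 : α < 1) (hτ : 0 < τ) (lam : 𝕜) (N : ℕ) :
    Continuous (differenceSum α τ lam N) :=
  continuous_finsetSum _ fun k _ => continuous_const.mul (RCLike.continuous_ofReal.comp
    ((continuous_differenceTerm hα0 hα1 hτ k).comp (continuous_id.sub continuous_const)))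

theorem hasGLDerivAt_ramps_add_differenceSum (hα0 : 0 < α) (hα1 : α < 1) (hτ : 0 < τ) (lam : 𝕜)
    {N : ℕ} {s : ℝ} (hs : 0 < s) (hN : s ≤ (N + 1) * τ) :
    HasGLDerivAt α (fun r => ((fracKernel 2 (r + τ) - fracKernel 2 r : ℝ) : 𝕜) +
      differenceSum α τ lam (N + 1) r) (lam * differenceSum α τ lam (N + 1) (s - τ)) s := by
  have hr : ∀ r, HasGLDerivAt α (fracKernel 2) (fracKernel (2 - α) r) r := by
    intro r
    have h := isFracFamily_fracKernel.hasGLDerivAt hα0 hα1 one_pos r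
    rwa [show (1 : ℝ) + 1 = 2 by norm_num, show 1 - α + 1 = 2 - α by ring] at h
  have h1 : HasGLDerivAt α (fun r => fracKernel 2 (r + τ)) (fracKernel (2 - α) (s + τ)) s := by
    have := (hr (s - -τ)).comp_sub_const
    simpa only [sub_neg_eq_add] using this
  have h2 := HasGLDerivAt.map (h1.sub (hr s)) (RCLike.ofRealCLM (K := 𝕜))
  have h3 : HasGLDerivAt α (differenceSum α τ lam (N + 1))
      (∑ k ∈ Finset.range (N + 1), lam ^ k * ((fracKernel (α * k + 2 - α) (s - k * τ) -
        shiftedFamily α τ (α * k + 1) (s - k * τ) : ℝ) : 𝕜)) s :=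
    HasGLDerivAt.sum _ fun k _ =>
      ((((hasGLDerivAt_differenceTerm hα0 hα1 hτ k (s - k * τ)).comp_sub_const).map
        (RCLike.ofRealCLM (K := 𝕜))).const_mul (lam ^ k))
  refine (congrArg (fun L => HasGLDerivAt α _ L s) ?_).mpr (h2.add h3)
  -- On the left `k = 0` is split off to meet the ramps. On the right `k = N` drops out because `s -
  -- τ - N τ ≤ 0`.
  rw [Finset.sum_range_succ', differenceSum, Finset.sum_range_succ,
    differenceTerm_of_nonpos hα0 hα1 hτ N (by linarith), RCLike.ofReal_zero, mul_zero, add_zero]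
  have e0 : fracKernel (2 - α) (s + τ) = shiftedFamily α τ 1 s := by
    rw [shiftedFamily_one hα1 hτ hs, fracKernel, if_pos (by linarith),
      show 2 - α - 1 = 1 - α by ring]
  have e : ∀ k : ℕ, fracKernel (α * (k + 1 : ℕ) + 2 - α) (s - (k + 1 : ℕ) * τ) -
      shiftedFamily α τ (α * (k + 1 : ℕ) + 1) (s - (k + 1 : ℕ) * τ) =
        differenceTerm α τ k (s - τ - k * τ) := by
    intro k
    rw [differenceTerm]
    push_cast
    congr 2 <;> ring
  simp only [e, Nat.cast_zero, mul_zero, zero_mul, sub_zero, zero_add, pow_zero, one_mul,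
    RCLike.ofRealCLM_apply, e0, Finset.mul_sum]
  have e1 : ∀ x z : ℝ, ((x - z : ℝ) : 𝕜) + ((z - x : ℝ) : 𝕜) = 0 := fun x z => by
    push_cast; ring
  rw [add_left_comm, e1, add_zero]
  exact Finset.sum_congr rfl fun k _ => by ring

theorem IsCaputoSolution.integral_deriv {lam : 𝕜} {f φ y : ℝ → 𝕜}
    (hy : IsCaputoSolution α τ lam f φ y) {s : ℝ} (hs : 0 ≤ s) :
    ∫ x in 0..max s 0, deriv y x = y s - y 0 := by
  rw [max_eq_left hs]
  rcases hs.eq_or_lt with rfl | hs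
  · simp
  · exact (hy.absolutelyContinuous s hs).integral_deriv_eq_sub_rclike

theorem IsCaputoSolution.hasGLDerivAt {lam : 𝕜} {f φ y : ℝ → 𝕜} (hα0 : 0 < α) (hα1 : α < 1)
    (hy : IsCaputoSolution α τ lam f φ y) {s : ℝ} (hs : 0 < s) :
    HasGLDerivAt α (fun r => ∫ x in 0..max r 0, deriv y x) (lam * y (s - τ) + f s) s := by
  obtain ⟨h1, h2⟩ := hy.equation s hs
  rw [← h2]
  exact hasGLDerivAt_primitive hα0 hα1 hs
    (hy.absolutelyContinuous s hs).intervalIntegrable_deriv_rclike h1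

theorem withHistory_linear_of_nonpos (hτ : 0 < τ) (y₀ : 𝕜) (y : ℝ → 𝕜) {s : ℝ} (hs : s ≤ 0) :
    withHistory τ (fun t : ℝ => ((t / τ + 1 : ℝ) : 𝕜) * y₀) y s =
      y₀ / (τ : 𝕜) * ((fracKernel 2 (s + τ) : ℝ) : 𝕜) := by
  have hτ' : (τ : 𝕜) ≠ 0 := RCLike.ofReal_ne_zero.2 hτ.ne'
  rw [withHistory, if_pos hs, historyExt, fracKernel_two]
  split_ifs with h
  · rw [max_eq_right (by linarith), neg_div, div_self hτ.ne']
    simp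
  · rw [max_eq_left (by linarith)]
    push_cast
    field_simp

end DelayEquation

/-! ### Comparison of the two solutions. -/

theorem mainTheorem5 {𝕜 : Type*} [RCLike 𝕜] (α τ : ℝ) (hα0 : 0 < α) (hα1 : α < 1) (hτ : 0 < τ)
    (lam y₀ : 𝕜) (f y yhat : ℝ → 𝕜)
    (hy : IsCaputoSolution α τ lam f (fun t : ℝ => ((t / τ + 1 : ℝ) : 𝕜) * y₀) y)
    (hyhat : IsModifiedSolution α τ lam f (fun t : ℝ => ((t / τ + 1 : ℝ) : 𝕜) * y₀) yhat)
    (t : ℝ) (ht : 0 < t) :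
    yhat t - y t =
      y₀ / (τ : 𝕜) * ∑ k ∈ Finset.range (⌊t / τ⌋₊ + 1), lam ^ k *
        (((t - k * τ) ^ (α * k + 1) / Real.Gamma (α * k + 2)
          - (t + τ - k * τ) ^ (α * k + 1) / Real.Gamma (α * k + 2)
            * (1 - regIncompleteBeta (τ / (t + τ - k * τ)) (2 - α) ((k + 1) * α)) : ℝ) : 𝕜) := by
  have hτ' : (τ : 𝕜) ≠ 0 := RCLike.ofReal_ne_zero.2 hτ.ne'
  set N := ⌊t / τ⌋₊ with hN
  set c : 𝕜 := y₀ / (τ : 𝕜) with hc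
  set S : ℝ → 𝕜 := differenceSum α τ lam (N + 1) with hS
  have hcτ : c * (τ : 𝕜) = y₀ := div_mul_cancel₀ _ hτ'
  have hy0 : y 0 = y₀ := by rw [hy.history 0 (by linarith) le_rfl]; simp
  have hyh0 : yhat 0 = y₀ := by rw [hyhat.history 0 (by linarith) le_rfl]; simp
  set Z : ℝ → 𝕜 := fun s =>
    withHistory τ (fun t : ℝ => ((t / τ + 1 : ℝ) : 𝕜) * y₀) yhat s -
      (∫ x in 0..max s 0, deriv y x) -
      c * (((fracKernel 2 (s + τ) - fracKernel 2 s : ℝ) : 𝕜) + S s) with hZ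
  have hZneg : ∀ s ≤ 0, Z s = 0 := by
    intro s hs
    simp only [hZ]
    rw [withHistory_linear_of_nonpos hτ y₀ yhat hs, max_eq_right hs,
      intervalIntegral.integral_same, fracKernel_of_nonpos 2 hs, hS,
      differenceSum_of_nonpos hα0 hα1 hτ lam _ hs]
    simp [hc]
  have hZnn : ∀ s, 0 ≤ s → Z s = yhat s - y s - c * S s := by
    intro s hs
    have hw : withHistory τ (fun t : ℝ => ((t / τ + 1 : ℝ) : 𝕜) * y₀) yhat s = yhat s := by
      rcases hs.eq_or_lt with rfl | hs
      · simp [withHistory, historyExt, hτ.le, hyh0]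
      · rw [withHistory, if_neg hs.not_ge]
    simp only [hZ]
    rw [hw, hy.integral_deriv hs, hy0, fracKernel_two, fracKernel_two, max_eq_left hs,
      max_eq_left (by linarith), add_sub_cancel_left, mul_add, hcτ]
    ring
  -- For `s > 0` the delayed argument `s - τ` lies strictly above `-τ`, so the values of the
  -- solutions at `-τ` itself never enter.
  have hZeq : ∀ s, -τ < s → Z s = yhat s - y s - c * S s := by
    intro s hs
    rcases le_or_gt s 0 with h | h
    · rw [hZneg s h, hy.history s hs h, hyhat.history s hs h, hS,
        differenceSum_of_nonpos hα0 hα1 hτ lam _ h]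
      simp
    · exact hZnn s h.le
  have hD : ∀ s, 0 < s → s ≤ (N + 1) * τ → HasGLDerivAt α Z (lam * Z (s - τ)) s := by
    intro s hs hsN
    have h := ((hyhat.equation s hs).sub (hy.hasGLDerivAt hα0 hα1 hs)).sub
      ((hasGLDerivAt_ramps_add_differenceSum hα0 hα1 hτ lam hs hsN).const_mul c)
    convert h using 1
    rw [hZeq (s - τ) (by linarith)]
    ring
  have hcont : ∀ T, ContinuousOn Z (Icc 0 T) := by
    intro T
    have hsub : Icc 0 T ⊆ Ici (-τ) := fun s hs => by
      simp only [mem_Ici]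
      linarith [hs.1]
    exact (((hyhat.continuousOn.mono hsub).sub (hy.continuousOn.mono hsub)).sub
      ((continuous_differenceSum hα0 hα1 hτ lam (N + 1)).const_smul c).continuousOn).congr
      fun s hs => hZnn s hs.1
  -- Method of steps. It stops at `n = N + 1` because the truncated sum solves the delay equation
  -- only up to `(N + 1) τ`, which already exceeds `t`.
  have hsteps : ∀ n : ℕ, n ≤ N + 1 → ∀ s ≤ n * τ, Z s = 0 := by
    intro n
    induction n with
    | zero => intro _ s hs; exact hZneg s (by simpa using hs)
    | succ n ih =>
      intro hn
      refine eq_zero_of_hasGLDerivAt_zero hα0 hα1 (hcont _) hZneg fun s hs hsn => ?_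
      have hnN : ((n + 1 : ℕ) : ℝ) ≤ N + 1 := by exact_mod_cast hn
      have h := hD s hs (hsn.trans (mul_le_mul_of_nonneg_right hnN hτ.le))
      rw [ih (by omega) (s - τ) (by push_cast at hsn; linarith), mul_zero] at h
      exact h
  have htN : t ≤ ((N + 1 : ℕ) : ℝ) * τ := by
    rw [← div_le_iff₀ hτ]
    push_cast
    exact (Nat.lt_floor_add_one _).le
  have hfin := hsteps (N + 1) le_rfl t htN
  rw [hZnn t ht.le, sub_eq_zero] at hfin
  rw [hfin, hS, differenceSum]
  congr 1
  refine Finset.sum_congr rfl fun k hk => ?_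
  have hkN : k ≤ N := by simpa [Nat.lt_succ_iff] using hk
  have hkt : (k : ℝ) * τ ≤ t := by
    rw [← le_div_iff₀ hτ]
    exact (Nat.le_floor_iff (by positivity)).1 hkN
  rw [differenceTerm_of_nonneg hα0 hα1 hτ k (by linarith),
    show t - k * τ + τ = t + τ - k * τ by ring]
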